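/- Let $H^2$ be the Hardy space of the unit disc: the space of functions $f(z)=\sum_{n\ge 0}a_nz^n$, $|z|<1$, with $\sum_{n\ge 0}|a_n|^2<\infty$, which is a complex Hilbert space for the inner product $\langle f,g\rangle=\sum_{n\ge 0}a_n\overline{b_n}$, where $g(z)=\sum_{n\ge 0}b_nz^n$. Let $S$ be the unilateral shift on $H^2$, $(Sf)(z)=zf(z)$. For a bounded operator $T$ on a complex Hilbert space $\mathcal H$ and an integer $k\ge 1$, let $$\Lambda_k(T)=\{\lambda\in\mathbb C : PTP=\lambda P \text{ for some orthogonal projection } P \text{ of rank } k \text{ on } \mathcal H\}$$ be the rank-$k$ numerical range of $T$. Then, for every integer $k\ge 1$, $$\Lambda_k(S)=D(0,1)=\{\lambda\in\mathbb C : |\lambda|<1\}.$$ -/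

import Mathlib

noncomputable section

/-- The rank-`k` numerical range `Λ_k(T)` of a bounded operator `T` on a complex Hilbert space:
the set of all `c : ℂ` such that `P T P = c P` for some orthogonal projection `P` of rank `k`. -/
def higherRankNumericalRange {H : Type*} [NormedAddCommGroup H] [InnerProductSpace ℂ H]
    [CompleteSpace H] (k : ℕ) (T : H →L[ℂ] H) : Set ℂ :=
  {c | ∃ P : H →L[ℂ] H, IsStarProjection P ∧
    LinearMap.rank (P : H →ₗ[ℂ] H) = (k : Cardinal) ∧ P * T * P = c • P}

/-- The open unit disc, as a type. -/
abbrev OpenUnitDisc : Type := Metric.ball (0 : ℂ) 1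

/-- The functions on the open unit disc given there by a power series `∑ aₙ zⁿ` with
square-summable coefficients. -/
def hardySubmodule : Submodule ℂ (OpenUnitDisc → ℂ) where
  carrier := {f | ∃ a : ℕ → ℂ, Summable (fun n => ‖a n‖ ^ 2) ∧
    ∀ z : OpenUnitDisc, HasSum (fun n => a n * (z : ℂ) ^ n) (f z)}
  zero_mem' := ⟨0, by simp, fun z => by simp⟩
  add_mem' := by
    rintro f g ⟨a, ha, hf⟩ ⟨b, hb, hg⟩
    refine ⟨a + b, ?_, fun z => ?_⟩
    · refine Summable.of_nonneg_of_le (fun n => by positivity) (fun n => ?_)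
        ((ha.mul_left 2).add (hb.mul_left 2))
      have h := norm_add_le (a n) (b n)
      have h0 := norm_nonneg (a n + b n)
      simp only [Pi.add_apply]
      nlinarith [sq_nonneg (‖a n‖ - ‖b n‖)]
    · simpa [add_mul] using (hf z).add (hg z)
  smul_mem' := by
    rintro c f ⟨a, ha, hf⟩
    refine ⟨c • a, ?_, fun z => ?_⟩
    · simpa [mul_pow] using ha.mul_left (‖c‖ ^ 2)
    · simpa [mul_assoc] using (hf z).mul_left c

/-- The Hardy space `H²` of the unit disc. -/
def HardySpace : Type := hardySubmodule

namespace HardySpace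

instance : AddCommGroup HardySpace := inferInstanceAs (AddCommGroup hardySubmodule)

instance : Module ℂ HardySpace := inferInstanceAs (Module ℂ hardySubmodule)

instance : CoeFun HardySpace (fun _ => OpenUnitDisc → ℂ) := ⟨fun f => f.1⟩

theorem ext_fun {f g : HardySpace} (h : ∀ z, f z = g z) : f = g := Subtype.ext (funext h)

theorem summable_sq (a : lp (fun _ : ℕ => ℂ) 2) : Summable (fun n => ‖a n‖ ^ 2) := by
  have h := (lp.memℓp a).summable (by norm_num)
  simpa using h

theorem summable_series {a : ℕ → ℂ} (ha : Summable (fun n => ‖a n‖ ^ 2)) (z : OpenUnitDisc) :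
    Summable (fun n => a n * (z : ℂ) ^ n) := by
  have hz : ‖(z : ℂ)‖ < 1 := mem_ball_zero_iff.mp z.2
  have hg : Summable (fun n => (‖(z : ℂ)‖ ^ 2) ^ n) :=
    summable_geometric_of_lt_one (by positivity) (by nlinarith [norm_nonneg (z : ℂ)])
  refine Summable.of_norm_bounded (ha.add hg) (fun n => ?_)
  rw [norm_mul, norm_pow, ← pow_mul, mul_comm 2 n, pow_mul]
  nlinarith [sq_nonneg (‖a n‖ - ‖(z : ℂ)‖ ^ n), sq_nonneg (‖a n‖), sq_nonneg (‖(z : ℂ)‖ ^ n)]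

/-- The function `z ↦ ∑ aₙ zⁿ` with a given square-summable coefficient sequence. -/
def ofCoeff : lp (fun _ : ℕ => ℂ) 2 →ₗ[ℂ] HardySpace where
  toFun a := ⟨fun z => ∑' n, a n * (z : ℂ) ^ n, a, summable_sq a,
    fun z => (summable_series (summable_sq a) z).hasSum⟩
  map_add' a b := by
    refine ext_fun fun z => ?_
    change ∑' n, (a n + b n) * (z : ℂ) ^ n = ∑' n, a n * (z : ℂ) ^ n + ∑' n, b n * (z : ℂ) ^ n
    simp only [add_mul]
    exact (summable_series (summable_sq a) z).tsum_add (summable_series (summable_sq b) z)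
  map_smul' c a := by
    refine ext_fun fun z => ?_
    change ∑' n, (c * a n) * (z : ℂ) ^ n = c * ∑' n, a n * (z : ℂ) ^ n
    simp only [mul_assoc, tsum_mul_left]

/-- The coefficients of a power series converging to `0` on the disc vanish. -/
theorem coeff_eq_zero {a : ℕ → ℂ}
    (h : ∀ z : OpenUnitDisc, HasSum (fun n => a n * (z : ℂ) ^ n) 0) : a = 0 := by
  have hp : HasFPowerSeriesAt (fun _ : ℂ => (0 : ℂ)) (FormalMultilinearSeries.ofScalars ℂ a) 0 := by
    rw [hasFPowerSeriesAt_iff]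
    filter_upwards [Metric.ball_mem_nhds (0 : ℂ) one_pos] with z hz
    simpa [FormalMultilinearSeries.coeff_ofScalars, mul_comm] using h ⟨z, hz⟩
  have h0 := hp.eq_zero
  funext n
  have := congrArg (fun p => FormalMultilinearSeries.coeff p n) h0
  rw [FormalMultilinearSeries.coeff_ofScalars] at this
  simpa [FormalMultilinearSeries.coeff] using this

theorem ofCoeff_bijective : Function.Bijective ofCoeff := by
  constructor
  · rw [injective_iff_map_eq_zero]
    intro a ha
    have h : (a : ℕ → ℂ) = 0 := coeff_eq_zero fun z => by
      have h1 := (summable_series (summable_sq a) z).hasSum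
      have h2 : ∑' n, a n * (z : ℂ) ^ n = 0 := congrFun (congrArg Subtype.val ha) z
      rwa [h2] at h1
    exact lp.ext h
  · rintro ⟨f, a, ha, hf⟩
    refine ⟨⟨a, memℓp_gen (by simpa using ha)⟩, ext_fun fun z => ?_⟩
    exact (hf z).tsum_eq

/-- The (linear, bijective) map sending `f ∈ H²` to its sequence of Taylor coefficients at `0`. -/
def coeff : HardySpace ≃ₗ[ℂ] lp (fun _ : ℕ => ℂ) 2 :=
  (LinearEquiv.ofBijective ofCoeff ofCoeff_bijective).symm

theorem hasSum_coeff (f : HardySpace) (z : OpenUnitDisc) :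
    HasSum (fun n => coeff f n * (z : ℂ) ^ n) (f z) := by
  have h := (summable_series (summable_sq (coeff f)) z).hasSum
  have h2 : ofCoeff (coeff f) = f :=
    (LinearEquiv.ofBijective ofCoeff ofCoeff_bijective).apply_symm_apply f
  have h3 : ∑' n, coeff f n * (z : ℂ) ^ n = f z := congrFun (congrArg Subtype.val h2) z
  rwa [h3] at h

/-- The norm of `H²` is the `ℓ²` norm of the sequence of Taylor coefficients. -/
instance : NormedAddCommGroup HardySpace :=
  NormedAddCommGroup.induced HardySpace (lp (fun _ : ℕ => ℂ) 2) coeff coeff.injective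

/-- The inner product of `H²` is the `ℓ²` inner product of the sequences of Taylor coefficients. -/
instance : InnerProductSpace ℂ HardySpace where
  norm_smul_le c f := by
    change ‖coeff (c • f)‖ ≤ ‖c‖ * ‖coeff f‖
    rw [map_smul, norm_smul]
  inner f g := inner ℂ (coeff f) (coeff g)
  norm_sq_eq_re_inner f := norm_sq_eq_re_inner (𝕜 := ℂ) (coeff f)
  conj_inner_symm f g := inner_conj_symm (coeff f) (coeff g)
  add_left f g h := by rw [map_add, inner_add_left]
  smul_left f g c := by rw [map_smul, inner_smul_left]

/-- `H²` is isometrically isomorphic to `ℓ²` through the Taylor coefficients. -/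
def coeffIsometry : HardySpace ≃ₗᵢ[ℂ] lp (fun _ : ℕ => ℂ) 2 where
  toLinearEquiv := coeff
  norm_map' _ := rfl

instance : CompleteSpace HardySpace :=
  coeffIsometry.toIsometryEquiv.completeSpace

theorem coeff_unique {f : HardySpace} {a : ℕ → ℂ}
    (h : ∀ z : OpenUnitDisc, HasSum (fun n => a n * (z : ℂ) ^ n) (f z)) :
    (coeff f : ℕ → ℂ) = a := by
  refine sub_eq_zero.mp (coeff_eq_zero fun z => ?_)
  simpa [sub_mul] using (hasSum_coeff f z).sub (h z)

theorem norm_sq_eq (f : HardySpace) : HasSum (fun n => ‖coeff f n‖ ^ 2) (‖f‖ ^ 2) := by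
  have h := lp.hasSum_norm (p := 2) (by norm_num) (coeff f)
  have hn : ‖coeff f‖ = ‖f‖ := rfl
  rw [hn] at h
  simpa using h

theorem hasSum_mul_z {a : ℕ → ℂ} {s z : ℂ} (h : HasSum (fun n => a n * z ^ n) s) :
    HasSum (fun n => (Nat.casesOn n 0 a : ℂ) * z ^ n) (z * s) := by
  rw [← hasSum_nat_add_iff' 1]
  simpa [pow_succ, mul_comm, mul_left_comm, mul_assoc] using h.mul_left z

/-- Multiplication by the variable, `f(z) ↦ z f(z)`, as a linear map of `H²`. -/
def mulZ : HardySpace →ₗ[ℂ] HardySpace where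
  toFun f := ⟨fun z => (z : ℂ) * f z, fun n => Nat.casesOn n 0 (coeff f),
    (summable_nat_add_iff 1).mp (summable_sq (coeff f)),
    fun z => hasSum_mul_z (hasSum_coeff f z)⟩
  map_add' f g := ext_fun fun z => mul_add (z : ℂ) (f z) (g z)
  map_smul' c f := ext_fun fun z => mul_left_comm (z : ℂ) c (f z)

theorem norm_mulZ (f : HardySpace) : ‖mulZ f‖ = ‖f‖ := by
  have hc : (coeff (mulZ f) : ℕ → ℂ) = fun n => Nat.casesOn n 0 (coeff f) :=
    coeff_unique fun z => hasSum_mul_z (hasSum_coeff f z)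
  have h1 := norm_sq_eq (mulZ f)
  rw [hc, ← hasSum_nat_add_iff' 1] at h1
  have h2 := h1.unique (by simpa using norm_sq_eq f)
  have h3 : ‖mulZ f‖ ^ 2 = ‖f‖ ^ 2 := by simpa using h2
  exact (sq_eq_sq₀ (norm_nonneg _) (norm_nonneg _)).mp h3

/-- The unilateral shift `S` on `H²`, `(S f)(z) = z f(z)`, as a bounded operator. -/
def shift : HardySpace →L[ℂ] HardySpace :=
  LinearIsometry.toContinuousLinearMap ⟨mulZ, norm_mulZ⟩

theorem shift_apply (f : HardySpace) (z : OpenUnitDisc) : shift f z = (z : ℂ) * f z := rfl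

end HardySpace

end

/-! ### Sequences with prescribed lag-one autocorrelation. -/

open scoped ComplexConjugate

/-! For `‖c‖ < 1`, a finitely supported unit sequence with lag-one autocorrelation `c` gives a unit
vector `v` with `⟪v, S v⟫ = c`. Copies of it in `k` disjoint blocks of monomials are orthonormal,
and `S` keeps each copy inside its block, so the compression of `S` to their span is `c`.
Conversely, if `P S P = c P` and `u = P u`, then, `S` being isometric, `‖S u - c u‖² = (1 - ‖c‖²)
‖u‖²`. When `‖c‖ ≥ 1` this forces `S u = c u`, that is `(z - c) u(z) = 0` on the disc, where `z - c`
has no zero; hence `u = 0`, impossible for every `u` in the range of a projection of positive rank.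
-/

/-- A number in the open unit disc is the lag-one autocorrelation of a finitely supported sequence
of norm one. -/
theorem exists_unit_seq_autocorrelation_eq {c : ℂ} (hc : ‖c‖ < 1) :
    ∃ (L : ℕ) (a : ℕ → ℂ), a L = 0 ∧ ∑ n ∈ Finset.range L, conj (a n) * a n = 1 ∧
      ∑ n ∈ Finset.range L, conj (a (n + 1)) * a n = c := by
  rcases eq_or_ne c 0 with rfl | h0
  · exact ⟨1, fun n => if n = 0 then 1 else 0, by simp, by simp, by simp⟩
  have hr : 0 < ‖c‖ := norm_pos_iff.mpr h0
  -- With `m = p + 1` this gives `(p + 1) * ‖c‖ ≤ p`, so that `p + 1` entries of squared modulus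
  -- `‖c‖ / p` have total mass at most `1`.
  obtain ⟨m, hm⟩ := exists_nat_gt (1 / (1 - ‖c‖))
  rw [div_lt_iff₀ (by linarith)] at hm
  have hm1 : (1 : ℝ) < m := by nlinarith [Nat.cast_nonneg (α := ℝ) m]
  obtain ⟨p, rfl⟩ : ∃ p, m = p + 1 :=
    Nat.exists_eq_succ_of_ne_zero (by rintro rfl; norm_num at hm1)
  push_cast at hm hm1
  have hp : (0 : ℝ) < p := by linarith
  set w : ℂ := conj c / ‖c‖ with hw
  have hrc : (‖c‖ : ℂ) ≠ 0 := by exact_mod_cast hr.ne'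
  have hww : conj w * w = 1 := by
    rw [hw, map_div₀, Complex.conj_conj, Complex.conj_ofReal, div_mul_div_comm, Complex.mul_conj,
      Complex.normSq_eq_norm_sq]
    field_simp
    push_cast
    ring
  have hpow (n : ℕ) : conj w ^ n * w ^ n = 1 := by rw [← mul_pow, hww, one_pow]
  set A : ℝ := √(‖c‖ / p) with hA
  have hAA : (A : ℂ) * A = ‖c‖ / p := by
    rw [← Complex.ofReal_mul, Real.mul_self_sqrt (by positivity)]; push_cast; rfl
  set B : ℝ := √(1 - (p + 1) * (‖c‖ / p)) with hB
  have hBB : (B : ℂ) * B = 1 - (p + 1) * (‖c‖ / p) := by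
    rw [← Complex.ofReal_mul, Real.mul_self_sqrt]
    · push_cast; rfl
    · rw [sub_nonneg, ← mul_div_assoc, div_le_one hp]; nlinarith
  have hpc : (p : ℂ) ≠ 0 := by exact_mod_cast hp.ne'
  -- The `p` adjacent pairs in the geometric run contribute `c / p` each. The missing mass `B ^ 2`
  -- sits after a zero at `p + 1`, so it does not affect the autocorrelation.
  refine ⟨p + 3, fun n => if n < p + 1 then A * w ^ n else if n = p + 2 then B else 0,
    by simp, ?_, ?_⟩
  · have key : ∀ n ∈ Finset.range (p + 1),
        conj (if n < p + 1 then A * w ^ n else if n = p + 2 then (B : ℂ) else 0) *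
          (if n < p + 1 then A * w ^ n else if n = p + 2 then (B : ℂ) else 0) = ‖c‖ / p := by
      intro n hn
      rw [if_pos (Finset.mem_range.mp hn), map_mul, map_pow, Complex.conj_ofReal, ← hAA]
      linear_combination (A : ℂ) * A * hpow n
    rw [Finset.sum_range_succ, Finset.sum_range_succ, Finset.sum_congr rfl key]
    simp [hBB]
  · have key : ∀ n ∈ Finset.range p,
        conj (if n + 1 < p + 1 then A * w ^ (n + 1) else if n + 1 = p + 2 then (B : ℂ) else 0) *
          (if n < p + 1 then A * w ^ n else if n = p + 2 then (B : ℂ) else 0) = c / p := by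
      intro n hn
      have hn := Finset.mem_range.mp hn
      rw [if_pos (by omega), if_pos (by omega), map_mul, map_pow, Complex.conj_ofReal]
      have hcw : conj w = c / ‖c‖ := by
        rw [hw, map_div₀, Complex.conj_conj, Complex.conj_ofReal]
      have : (A : ℂ) * conj w ^ (n + 1) * (A * w ^ n) = A * A * conj w := by
        linear_combination (A : ℂ) * A * conj w * hpow n
      rw [this, hAA, hcw]
      field_simp
    rw [Finset.sum_range_succ, Finset.sum_range_succ, Finset.sum_range_succ,
      Finset.sum_congr rfl key]
    simp [mul_div_cancel₀ _ hpc]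

/-! ### Numerical ranges of operators on an abstract Hilbert space. -/

section InnerProductSpace

variable {H : Type*} [NormedAddCommGroup H] [InnerProductSpace ℂ H]

theorem mul_add_eq_mul_add_iff_of_lt {N i j m n : ℕ} (hm : m < N) (hn : n < N) :
    i * N + m = j * N + n ↔ i = j ∧ m = n := by
  refine ⟨fun h => ?_, by rintro ⟨rfl, rfl⟩; rfl⟩
  have hN : 0 < N := by omega
  have h1 := congrArg (· / N) h
  have h2 := congrArg (· % N) h
  simp only [mul_comm _ N, Nat.mul_add_div hN, Nat.mul_add_mod, Nat.div_eq_of_lt, hm, hn,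
    Nat.mod_eq_of_lt, add_zero] at h1 h2
  exact ⟨h1, h2⟩

/-- An orthonormal family with `⟪vᵢ, T vⱼ⟫ = c δᵢⱼ` puts `c` in the higher-rank numerical range. -/
theorem mem_higherRankNumericalRange_of_orthonormal [CompleteSpace H] {k : ℕ} {T : H →L[ℂ] H}
    {c : ℂ} {v : Fin k → H} (hv : Orthonormal ℂ v)
    (hT : ∀ i j, inner ℂ (v i) (T (v j)) = if i = j then c else 0) :
    c ∈ higherRankNumericalRange k T := by
  have hfin : FiniteDimensional ℂ (Submodule.span ℂ (Set.range v)) :=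
    FiniteDimensional.span_of_finite ℂ (Set.finite_range v)
  set U := Submodule.span ℂ (Set.range v) with hU
  refine ⟨U.starProjection, isStarProjection_starProjection, ?_, ?_⟩
  · have hrange : LinearMap.range (U.starProjection : H →ₗ[ℂ] H) = U := U.range_starProjection
    rw [LinearMap.rank, hrange, ← Module.finrank_eq_rank,
      finrank_span_eq_card hv.linearIndependent, Fintype.card_fin]
  -- By linearity, `T u - c • u ⊥ U` need only be tested on the `v i`.
  · have key : ∀ u ∈ U, U.starProjection (T u - c • u) = 0 := by
      intro u hu
      induction hu using Submodule.span_induction with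
      | mem x hx =>
        obtain ⟨j, rfl⟩ := hx
        rw [Submodule.starProjection_apply_eq_zero_iff, hU, Submodule.mem_orthogonal]
        intro y hy
        induction hy using Submodule.span_induction with
        | mem y hy =>
          obtain ⟨i, rfl⟩ := hy
          rw [inner_sub_right, inner_smul_right, hT, orthonormal_iff_ite.mp hv]
          split_ifs <;> simp
        | zero => simp
        | add y z _ _ h1 h2 => rw [inner_add_left, h1, h2, add_zero]
        | smul a y _ h => rw [inner_smul_left, h, mul_zero]
      | zero => simp
      | add x y _ _ h1 h2 =>
        rw [map_add, smul_add, add_sub_add_comm, map_add, h1, h2, add_zero]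
      | smul a x _ h => rw [map_smul, smul_comm c a, ← smul_sub, map_smul, h, smul_zero]
    ext x
    have hx := key _ (U.starProjection_apply_mem x)
    have hP : U.starProjection (U.starProjection x) = U.starProjection x :=
      Submodule.starProjection_eq_self_iff.mpr (U.starProjection_apply_mem x)
    rw [map_sub, map_smul, hP, sub_eq_zero] at hx
    exact hx

/-- If `T` shifts an orthonormal sequence, every higher-rank numerical range of `T` contains the
open unit disc. -/
theorem ball_subset_higherRankNumericalRange [CompleteSpace H] {T : H →L[ℂ] H} {e : ℕ → H}
    (he : Orthonormal ℂ e) (hT : ∀ n, T (e n) = e (n + 1)) (k : ℕ) :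
    Metric.ball (0 : ℂ) 1 ⊆ higherRankNumericalRange k T := by
  intro c hc
  obtain ⟨L, a, haL, ha1, hac⟩ := exists_unit_seq_autocorrelation_eq (mem_ball_zero_iff.mp hc)
  rw [orthonormal_iff_ite] at he
  -- Stride `L + 1` rather than `L`: the spare slot keeps `T (v j)` inside block `j`.
  let v : Fin k → H := fun j => ∑ n ∈ Finset.range L, a n • e (j * (L + 1) + n)
  refine mem_higherRankNumericalRange_of_orthonormal (v := v) ?_ fun i j => ?_
  · rw [orthonormal_iff_ite]
    intro i j
    have key : ∀ n ∈ Finset.range L, ∀ m ∈ Finset.range L,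
        inner ℂ (a m • e (i * (L + 1) + m)) (a n • e (j * (L + 1) + n)) =
          if m = n then (if i = j then conj (a m) * a n else 0) else 0 := by
      intro n hn m hm
      rw [Finset.mem_range] at hn hm
      rw [inner_smul_left, inner_smul_right, he,
        if_congr (mul_add_eq_mul_add_iff_of_lt (by omega) (by omega)) rfl rfl]
      by_cases hij : i = j <;> by_cases hmn : m = n <;> simp [hij, hmn, Fin.val_inj]
    have : inner ℂ (v i) (v j) =
        ∑ n ∈ Finset.range L, if i = j then conj (a n) * a n else 0 := by
      simp only [v, inner_sum, sum_inner]
      refine Finset.sum_congr rfl fun n hn => ?_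
      rw [Finset.sum_congr rfl (key n hn), Finset.sum_ite_eq', if_pos hn]
    rw [this]
    split_ifs
    · exact ha1
    · simp
  · have key : ∀ n ∈ Finset.range L, ∀ m ∈ Finset.range L,
        inner ℂ (a m • e (i * (L + 1) + m)) (a n • e (j * (L + 1) + n + 1)) =
          if m = n + 1 then (if i = j then conj (a m) * a n else 0) else 0 := by
      intro n hn m hm
      rw [Finset.mem_range] at hn hm
      rw [inner_smul_left, inner_smul_right, he, add_assoc,
        if_congr (mul_add_eq_mul_add_iff_of_lt (by omega) (by omega)) rfl rfl]
      by_cases hij : i = j <;> by_cases hmn : m = n + 1 <;> simp [hij, hmn, Fin.val_inj]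
    have : inner ℂ (v i) (T (v j)) =
        ∑ n ∈ Finset.range L, if i = j then conj (a (n + 1)) * a n else 0 := by
      simp only [v, map_sum, map_smul, hT, inner_sum, sum_inner]
      refine Finset.sum_congr rfl fun n hn => ?_
      rw [Finset.sum_congr rfl (key n hn), Finset.sum_ite_eq']
      split_ifs with h1 h2 h2 <;> try rfl
      -- Only the last entry is shifted off the support of `v i`; its term vanishes because `a L =
      -- 0`.
      have hn' : n + 1 = L := by rw [Finset.mem_range] at h1 hn; omega
      rw [hn', haL, map_zero, zero_mul]
    rw [this]
    split_ifs
    · exact hac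
    · simp

/-- For an isometry `T`, a point of a higher-rank numerical range outside the open unit disc is an
eigenvalue of `T`. -/
theorem exists_eigenvector_of_mem_higherRankNumericalRange [CompleteSpace H] {T : H →L[ℂ] H}
    (hT : ∀ x, ‖T x‖ = ‖x‖) {k : ℕ} (hk : 1 ≤ k) {c : ℂ}
    (hc : c ∈ higherRankNumericalRange k T) (h1 : 1 ≤ ‖c‖) : ∃ f ≠ 0, T f = c • f := by
  obtain ⟨P, hP, hrank, hPTP⟩ := hc
  have hP0 : P ≠ 0 := by
    rintro rfl
    rw [ContinuousLinearMap.toLinearMap_zero, LinearMap.rank_zero] at hrank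
    have : k = 0 := by exact_mod_cast hrank.symm
    omega
  obtain ⟨x, hx⟩ : ∃ x, P x ≠ 0 := by
    by_contra! h
    exact hP0 (ContinuousLinearMap.ext h)
  have hPP : P (P x) = P x := congrArg (· x) hP.isIdempotentElem.eq
  have hadj : ContinuousLinearMap.adjoint P = P := hP.isSelfAdjoint
  refine ⟨P x, hx, ?_⟩
  have hcomp : P (T (P x)) = c • P x := congrArg (· x) hPTP
  have hinner : inner ℂ (T (P x)) (P x) = conj c * (‖P x‖ : ℂ) ^ 2 := by
    calc inner ℂ (T (P x)) (P x) = inner ℂ (T (P x)) (P (P x)) := by rw [hPP]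
      _ = inner ℂ (P (T (P x))) (P x) := by
        rw [← ContinuousLinearMap.adjoint_inner_left, hadj]
      _ = conj c * (‖P x‖ : ℂ) ^ 2 := by
        rw [hcomp, inner_smul_left, inner_self_eq_norm_sq_to_K]
        rfl
  have hre : RCLike.re (inner ℂ (T (P x)) (c • P x)) = ‖c‖ ^ 2 * ‖P x‖ ^ 2 := by
    rw [inner_smul_right, hinner, ← mul_assoc, Complex.mul_conj, Complex.normSq_eq_norm_sq]
    norm_cast
  have hnorm := norm_sub_sq (𝕜 := ℂ) (T (P x)) (c • P x)
  rw [hre, hT, norm_smul, mul_pow] at hnorm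
  -- The expansion equals `(1 - ‖c‖ ^ 2) * ‖P x‖ ^ 2`.
  have hle : ‖T (P x) - c • P x‖ ^ 2 ≤ 0 := by
    rw [hnorm]
    nlinarith [sq_nonneg ‖P x‖, mul_nonneg (sub_nonneg.mpr (one_le_pow₀ h1 (n := 2)))
      (sq_nonneg ‖P x‖)]
  have h0 : ‖T (P x) - c • P x‖ = 0 := pow_eq_zero_iff two_ne_zero |>.mp (hle.antisymm (sq_nonneg _))
  exact sub_eq_zero.mp (norm_eq_zero.mp h0)

end InnerProductSpace

/-! ### The shift on the Hardy space. -/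

namespace HardySpace

/-- The shift has no eigenvalue outside the open unit disc. -/
theorem eq_zero_of_shift_eq_smul {f : HardySpace} {c : ℂ} (hc : 1 ≤ ‖c‖)
    (h : shift f = c • f) : f = 0 := by
  refine ext_fun fun z => ?_
  have hz : (z : ℂ) * f z = c * f z := by
    rw [← shift_apply, h]
    rfl
  have hne : (z : ℂ) - c ≠ 0 := fun h0 => by
    have hz1 : ‖(z : ℂ)‖ < 1 := mem_ball_zero_iff.mp z.2
    rw [sub_eq_zero.mp h0] at hz1
    linarith
  have hmul : ((z : ℂ) - c) * f z = 0 := by rw [sub_mul, hz, sub_self]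
  exact (mul_eq_zero.mp hmul).resolve_left hne

/-- The monomial `z ^ n` in `H²`. -/
noncomputable def monomial (n : ℕ) : HardySpace := coeffIsometry.symm (lp.single 2 n (1 : ℂ))

theorem coeff_monomial (n : ℕ) : coeff (monomial n) = lp.single 2 n (1 : ℂ) :=
  coeff.apply_symm_apply _

theorem monomial_apply (n : ℕ) (z : OpenUnitDisc) : monomial n z = (z : ℂ) ^ n := by
  have h := hasSum_coeff (monomial n) z
  rw [coeff_monomial] at h
  refine h.unique ?_
  convert hasSum_ite_eq n ((z : ℂ) ^ n) using 2 with m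
  rw [lp.single_apply]
  by_cases hmn : m = n
  · subst hmn; simp
  · simp [hmn]

theorem orthonormal_monomial : Orthonormal ℂ monomial := by
  rw [orthonormal_iff_ite]
  intro i j
  change inner ℂ (coeff (monomial i)) (coeff (monomial j)) = _
  rw [coeff_monomial, coeff_monomial, lp.inner_single_left, lp.single_apply]
  by_cases hij : i = j
  · subst hij; simp
  · simp [hij]

theorem shift_monomial (n : ℕ) : shift (monomial n) = monomial (n + 1) :=
  ext_fun fun z => by rw [shift_apply, monomial_apply, monomial_apply, pow_succ']

theorem norm_shift (f : HardySpace) : ‖shift f‖ = ‖f‖ := norm_mulZ f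

end HardySpace

theorem theorem2p2 (k : ℕ) (hk : 1 ≤ k) :
    higherRankNumericalRange k HardySpace.shift = Metric.ball (0 : ℂ) 1 := by
  refine Set.Subset.antisymm (fun c hc => ?_) (ball_subset_higherRankNumericalRange
    HardySpace.orthonormal_monomial HardySpace.shift_monomial k)
  by_contra h
  rw [mem_ball_zero_iff, not_lt] at h
  obtain ⟨f, hf, hfc⟩ :=
    exists_eigenvector_of_mem_higherRankNumericalRange HardySpace.norm_shift hk hc h
  exact hf (HardySpace.eq_zero_of_shift_eq_smul h hfc)
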